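/- **Setting.** For a finite set $V$ of symbols and $p\ge 0$, an ordered $p$-forest on $V\cup\{z\}$ is a graph on this vertex set without cycles, with exactly $p$ edges, numbered $1,\dots,p$. Let $\mathcal A^p(V)$ be the complex vector space generated by the ordered $p$-forests, modulo (R1) $T_1=-T_2$ if $T_1,T_2$ have the same graph and their edge orders differ by a transposition; (R2) $T_1+T_2+T_3=0$ if, for some vertices $u,v,w$ and numbers $a\neq b$, the edges with numbers $(a,b)$ are $(uv,uw)$ in $T_1$, $(vw,uv)$ in $T_2$, $(uw,vw)$ in $T_3$, and all other edges agree. For $t\in V$ the residue $\mathrm{res}_t:\mathcal A^p(V)\to\mathcal A^{p-1}(V\setminus\{t\})$ is defined as follows: if $T$ has an edge $zt$, with number $a$, contract this edge to the vertex $z$, decrease the numbers greater than $a$ by $1$, and multiply by $(-1)^{a-1}$; otherwise $\mathrm{res}_tT=0$. For $k=(k_1,\dots,k_r)\in\mathbb N^r$ let $|k|=\sum_i k_i$, let $V_k=\{t^{(i)}_j: 1\le i\le r,\ 1\le j\le k_i\}$, and let $\mathcal A(k)\subset\mathcal A^{|k|}(V_k)$ be the subspace of elements that are skew-invariant under $G_k=\prod_i\Sigma_{k_i}$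 (permuting the lower indices). Put $\mathrm{res}^{(i)}_j=\mathrm{res}_{t^{(i)}_j}$. Let $U_r$ be the free associative complex algebra on $\tilde f_1,\dots,\tilde f_r$ and $U[k]$ its part of multidegree $k$. For a $k$-multiindex $J$, i.e. a map $J:\{1,\dots,|k|\}\to\{1,\dots,r\}$ with $\#J^{-1}(i)=k_i$ for all $i$, let $\tilde f_J=\tilde f_{J(|k|)}\cdots\tilde f_{J(1)}$, let $c(s)=\#\{s'\le s: J(s')=J(s)\}$, and let $\mathrm{sgn}(J)=(-1)^{\mathrm{inv}(J)}$, where $\mathrm{inv}(J)$ is the number of pairs $s<s'$ with $J(s)>J(s')$. For $T\in\mathcal A(k)$, $\langle\tilde f_J,T\rangle$ is the number with $$\mathrm{sgn}(J)\,\mathrm{res}^{(J(|k|))}_{c(|k|)}\cdots\mathrm{res}^{(J(1))}_{c(1)}T=\langle\tilde f_J,T\rangle\cdot T_0,$$ where $T_0$ is the graph with the single vertex $z$; extend linearly to $U[k]$. This is a perfect pairing of $U[k]$ and $\mathcal A(k)$; let $\Omega_k=\sum_J \tilde f_J^*\otimes \tilde f_J\in\mathcal A(k)\otimes U[k]$ be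 its canonical element, where $\tilde f_J^*$ is the dual basis. Let $\mathfrak g$ be a finite-dimensional simple complex Lie algebra of rank $r$, with a Cartan subalgebra $\mathfrak h$, simple roots $\alpha_1,\dots,\alpha_r$ and Chevalley generators $e_i,h_i,f_i$. Let $\mathfrak n$ be the subalgebra generated by $f_1,\dots,f_r$, so that $\mathfrak n=\bigoplus_{\beta>0}\mathfrak n_\beta$, where $\mathfrak n_\beta$ is the root space of $-\beta$, and let $q:U_r\to U(\mathfrak n)$ be the homomorphism with $\tilde f_i\mapsto f_i$. The ideal of Serre relations is the two-sided ideal of $U_r$ generated by $\mathrm{ad}(\tilde f_i)^{1-\alpha_j(h_i)}(\tilde f_j)$, $i\ne j$. Choose a linear ordering $\beta_1<\dots<\beta_m$ of the positive roots and a generator $F_{\beta_j}$ of each $\mathfrak n_{\beta_j}$; let $k^{(j)}\in\mathbb N^r$ be given by $\beta_j=\sum_i k^{(j)}_i\alpha_i$. By the Poincaré–Birkhoff–Witt theorem the elements $F^p=F_{\beta_1}^{p_1}\cdots F_{\beta_m}^{p_m}$, $p\in\mathbb N^m$, form a basis of $U(\mathfrak n)$, so that $$(\mathrm{id}\otimes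 q)(\Omega_k)=\sum_p T_p\otimes F^p,\qquad T_p\in\mathcal A(k),$$ where $p$ runs over the exponents with $\sum_j p_jk^{(j)}=k$. Let $\eta_{\beta_j}\in\mathcal A(k^{(j)})$ be the coefficient $T_p$ of $F^p=F_{\beta_j}$ (for $k=k^{(j)}$). **Theorem.** Suppose that elements $\bar\eta_{\beta_j}\in\mathcal A(k^{(j)})$, $j=1,\dots,m$, satisfy, for every $j$: (i) $\langle\tilde F,\bar\eta_{\beta_j}\rangle=0$ for every $\tilde F\in U[k^{(j)}]$ that belongs to the ideal of Serre relations; (ii) $\mathrm{res}^{(i)}_{k_i}\bar\eta_{\beta_j}=\mathrm{res}^{(i)}_{k_i}\eta_{\beta_j}$, with $k=k^{(j)}$, for all $i=1,\dots,r$ with $k^{(j)}_i>0$. Then $\bar\eta_{\beta_j}=\eta_{\beta_j}$ for all $j=1,\dots,m$. -/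

import Mathlib

open scoped TensorProduct

noncomputable section

namespace CanElt

/-- The edges `e 0, …, e (p - 1)`, in this order, form an ordered `p`-forest on the vertex set
`V ∪ {z}`, with the root `z` written as `none`: they are `p` distinct edges, none of them is a loop,
and the graph that they form has no cycles. -/
structure IsForest {V : Type} {p : ℕ} (e : Fin p → Sym2 (Option V)) : Prop where
  injective : Function.Injective e
  loopless : ∀ a, ¬ (e a).IsDiag
  acyclic : (SimpleGraph.fromEdgeSet (Set.range e)).IsAcyclic

/-- Two vertices are joined by an edge other than the `i`-th one. -/
def Joined {V : Type} {p : ℕ} (e : Fin p → Sym2 (Option V)) (i : Fin p) (x y : Option V) : Prop :=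
  ∃ j, j ≠ i ∧ e j = s(x, y)

theorem Joined.symm {V : Type} {p : ℕ} {e : Fin p → Sym2 (Option V)} {i : Fin p} {x y : Option V}
    (h : Joined e i x y) : Joined e i y x := by
  obtain ⟨j, hj, h⟩ := h
  exact ⟨j, hj, by rw [h, Sym2.eq_swap]⟩

theorem isForest_iff {V : Type} {p : ℕ} (e : Fin p → Sym2 (Option V)) :
    IsForest e ↔ ∀ i x y, e i = s(x, y) → ¬ Relation.ReflTransGen (Joined e i) x y := by
  constructor
  · intro h i x y hi hr
    have hne : x ≠ y := by
      rintro rfl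
      exact h.loopless i (by rw [hi]; simp)
    have hadj : (SimpleGraph.fromEdgeSet (Set.range e)).Adj x y := by
      rw [SimpleGraph.fromEdgeSet_adj]
      exact ⟨⟨i, hi⟩, hne⟩
    have hb := SimpleGraph.isAcyclic_iff_forall_adj_isBridge.1 h.acyclic hadj
    rw [SimpleGraph.isBridge_iff] at hb
    apply hb
    rw [SimpleGraph.reachable_iff_reflTransGen]
    refine Relation.ReflTransGen.mono ?_ _ _ hr
    rintro a b ⟨j, hj, hab⟩
    rw [SimpleGraph.deleteEdges_adj, SimpleGraph.fromEdgeSet_adj]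
    refine ⟨⟨⟨j, hab⟩, ?_⟩, ?_⟩
    · rintro rfl
      exact h.loopless j (by rw [hab]; simp)
    · rw [Set.mem_singleton_iff, ← hab, ← hi]
      exact fun h' => hj (h.injective h')
  · intro h
    refine ⟨?_, ?_, ?_⟩
    · intro i j hij
      by_contra hne
      obtain ⟨x, y, hxy⟩ : ∃ x y, e i = s(x, y) := by
        induction h' : e i with | _ x y => exact ⟨x, y, rfl⟩
      exact h i x y hxy (.single ⟨j, fun h => hne h.symm, by rw [← hij, hxy]⟩)
    · intro i hd
      obtain ⟨x, y, hxy⟩ : ∃ x y, e i = s(x, y) := by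
        induction h' : e i with | _ x y => exact ⟨x, y, rfl⟩
      rw [hxy, Sym2.mk_isDiag_iff] at hd
      subst hd
      exact h i x x hxy .refl
    · rw [SimpleGraph.isAcyclic_iff_forall_adj_isBridge]
      intro x y hadj
      rw [SimpleGraph.fromEdgeSet_adj] at hadj
      obtain ⟨⟨i, hi⟩, hne⟩ := hadj
      rw [SimpleGraph.isBridge_iff]
      intro hr
      rw [SimpleGraph.reachable_iff_reflTransGen] at hr
      refine h i x y hi (Relation.ReflTransGen.mono ?_ _ _ hr)
      intro a b hab
      rw [SimpleGraph.deleteEdges_adj, SimpleGraph.fromEdgeSet_adj] at hab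
      obtain ⟨⟨⟨j, hj⟩, _⟩, hn⟩ := hab
      refine ⟨j, ?_, hj⟩
      rintro rfl
      exact hn (by rw [← hj, hi]; rfl)

theorem IsForest.comp_equiv {V : Type} {p : ℕ} {e : Fin p → Sym2 (Option V)} (h : IsForest e)
    (σ : Equiv.Perm (Fin p)) : IsForest (e ∘ σ) :=
  ⟨h.injective.comp σ.injective, fun a => h.loopless _, by
    rw [σ.surjective.range_comp]; exact h.acyclic⟩

theorem isForest_comp_equiv {V : Type} {p : ℕ} {e : Fin p → Sym2 (Option V)}
    (σ : Equiv.Perm (Fin p)) : IsForest (e ∘ σ) ↔ IsForest e := by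
  refine ⟨fun h => ?_, fun h => h.comp_equiv σ⟩
  have := h.comp_equiv σ⁻¹
  convert this using 1
  ext i
  simp

/-- The ordered `p`-forests on the vertex set `V ∪ {z}`. -/
abbrev OrderedForest (V : Type) (p : ℕ) : Type :=
  {e : Fin p → Sym2 (Option V) // IsForest e}

/-- The two kinds of relations between ordered forests. The first: exchanging the positions of two
edges changes the sign. The second: for vertices `u, v, w` and positions `a ≠ b`, the sum of the
three forests whose edges at `(a, b)` are `(uv, uw)`, `(vw, uv)`, `(uw, vw)`, and which agree
elsewhere, is zero. (The vertices `u, v, w` are automatically distinct, because forests have neither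
loops nor repeated edges.) -/
def forestRelations (V : Type) (p : ℕ) : Set (OrderedForest V p →₀ ℂ) :=
  {x | ∃ (T₁ T₂ : OrderedForest V p) (a b : Fin p), a ≠ b ∧ T₂.1 = T₁.1 ∘ Equiv.swap a b ∧
      x = Finsupp.single T₁ 1 + Finsupp.single T₂ 1} ∪
  {x | ∃ (T₁ T₂ T₃ : OrderedForest V p) (a b : Fin p) (u v w : Option V), a ≠ b ∧
      (T₁.1 a = s(u, v) ∧ T₁.1 b = s(u, w)) ∧
      (T₂.1 a = s(v, w) ∧ T₂.1 b = s(u, v)) ∧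
      (T₃.1 a = s(u, w) ∧ T₃.1 b = s(v, w)) ∧
      (∀ c, c ≠ a → c ≠ b → T₁.1 c = T₂.1 c ∧ T₂.1 c = T₃.1 c) ∧
      x = Finsupp.single T₁ 1 + Finsupp.single T₂ 1 + Finsupp.single T₃ 1}

/-- The space `𝒜^p` of ordered `p`-forests on `V ∪ {z}` modulo the relations. -/
abbrev ForestSpace (V : Type) (p : ℕ) : Type :=
  (OrderedForest V p →₀ ℂ) ⧸ Submodule.span ℂ (forestRelations V p)

open Classical in
/-- The class of an ordered forest, extended by zero to sequences of edges that are not forests. -/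
def cls {V : Type} {p : ℕ} (e : Fin p → Sym2 (Option V)) : ForestSpace V p :=
  if h : IsForest e then Submodule.Quotient.mk (Finsupp.single ⟨e, h⟩ 1) else 0

theorem cls_swap {V : Type} {p : ℕ} (e : Fin p → Sym2 (Option V)) {a b : Fin p} (hab : a ≠ b) :
    cls (e ∘ Equiv.swap a b) = - cls e := by
  by_cases h : IsForest e
  · have h' : IsForest (e ∘ Equiv.swap a b) := h.comp_equiv _
    rw [cls, cls, dif_pos h, dif_pos h', eq_neg_iff_add_eq_zero, add_comm,
      ← Submodule.Quotient.mk_add, Submodule.Quotient.mk_eq_zero]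
    exact Submodule.subset_span (Or.inl ⟨⟨e, h⟩, ⟨_, h'⟩, a, b, hab, rfl, rfl⟩)
  · have h' : ¬ IsForest (e ∘ Equiv.swap a b) := by rwa [isForest_comp_equiv]
    rw [cls, cls, dif_neg h, dif_neg h', neg_zero]

theorem cls_perm {V : Type} {p : ℕ} (e : Fin p → Sym2 (Option V)) (σ : Equiv.Perm (Fin p)) :
    cls (e ∘ σ) = ((Equiv.Perm.sign σ : ℤ) : ℂ) • cls e := by
  induction σ using Equiv.Perm.swap_induction_on generalizing e with
  | one => simp
  | swap_mul σ x y hxy ih =>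
    rw [Equiv.Perm.coe_mul, ← Function.comp_assoc, ih, cls_swap e hxy, Equiv.Perm.sign_mul,
      Equiv.Perm.sign_swap hxy]
    simp

theorem cls_triangle {V : Type} {p : ℕ} {e₁ e₂ e₃ : Fin p → Sym2 (Option V)}
    (h₁ : IsForest e₁) (h₂ : IsForest e₂) (h₃ : IsForest e₃) {a b : Fin p} {u v w : Option V}
    (hab : a ≠ b) (t₁ : e₁ a = s(u, v) ∧ e₁ b = s(u, w)) (t₂ : e₂ a = s(v, w) ∧ e₂ b = s(u, v))
    (t₃ : e₃ a = s(u, w) ∧ e₃ b = s(v, w))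
    (hc : ∀ c, c ≠ a → c ≠ b → e₁ c = e₂ c ∧ e₂ c = e₃ c) :
    cls e₁ + cls e₂ + cls e₃ = 0 := by
  rw [cls, cls, cls, dif_pos h₁, dif_pos h₂, dif_pos h₃, ← Submodule.Quotient.mk_add,
    ← Submodule.Quotient.mk_add, Submodule.Quotient.mk_eq_zero]
  exact Submodule.subset_span (Or.inr ⟨⟨_, h₁⟩, ⟨_, h₂⟩, ⟨_, h₃⟩, a, b, u, v, w, hab, t₁, t₂, t₃,
    hc, rfl⟩)

/-- A linear map on the space of forests is given by values on forests respecting the relations. -/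
def ForestSpace.lift {V : Type} {p : ℕ} {M : Type} [AddCommGroup M] [Module ℂ M]
    (φ : (Fin p → Sym2 (Option V)) → M)
    (h₁ : ∀ e, IsForest e → ∀ a b, a ≠ b → φ e + φ (e ∘ Equiv.swap a b) = 0)
    (h₂ : ∀ e₁ e₂ e₃, IsForest e₁ → IsForest e₂ → IsForest e₃ → ∀ a b u v w, a ≠ b →
      (e₁ a = s(u, v) ∧ e₁ b = s(u, w)) → (e₂ a = s(v, w) ∧ e₂ b = s(u, v)) →
      (e₃ a = s(u, w) ∧ e₃ b = s(v, w)) →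
      (∀ c, c ≠ a → c ≠ b → e₁ c = e₂ c ∧ e₂ c = e₃ c) → φ e₁ + φ e₂ + φ e₃ = 0) :
    ForestSpace V p →ₗ[ℂ] M :=
  Submodule.liftQ _ (Finsupp.linearCombination ℂ fun T : OrderedForest V p => φ T.1) <| by
    rw [Submodule.span_le]
    rintro x (⟨T₁, T₂, a, b, hab, hT, rfl⟩ | ⟨T₁, T₂, T₃, a, b, u, v, w, hab, t₁, t₂, t₃, hc, rfl⟩)
    · simpa [hT] using h₁ T₁.1 T₁.2 a b hab
    · simpa using h₂ T₁.1 T₂.1 T₃.1 T₁.2 T₂.2 T₃.2 a b u v w hab t₁ t₂ t₃ hc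

theorem ForestSpace.lift_cls {V : Type} {p : ℕ} {M : Type} [AddCommGroup M] [Module ℂ M]
    (φ : (Fin p → Sym2 (Option V)) → M) (h₁) (h₂) {e : Fin p → Sym2 (Option V)} (he : IsForest e) :
    ForestSpace.lift φ h₁ h₂ (cls e) = φ e := by
  rw [cls, dif_pos he, ForestSpace.lift]
  erw [Submodule.liftQ_apply]
  simp

theorem exists_perm_succAbove {n : ℕ} (σ : Equiv.Perm (Fin (n + 1))) (a : Fin (n + 1)) :
    ∃ ρ : Equiv.Perm (Fin n),
      ((Equiv.Perm.sign ρ : ℤ) : ℂ) = (-1) ^ (σ a : ℕ) * (Equiv.Perm.sign σ : ℤ) * (-1) ^ (a : ℕ) ∧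
      ∀ s, σ (a.succAbove s) = (σ a).succAbove (ρ s) := by
  set τ : Equiv.Perm (Fin (n + 1)) := (σ a).cycleRange * σ * a.cycleRange⁻¹ with hτ
  have h0 : τ 0 = 0 := by
    simp [hτ, Equiv.Perm.inv_def]
  obtain ⟨⟨q, ρ⟩, hρ⟩ := Equiv.Perm.decomposeFin.symm.surjective τ
  have hq : q = 0 := by
    rw [← hρ] at h0
    simpa using h0
  subst hq
  refine ⟨ρ, ?_, ?_⟩
  · have h1 : Equiv.Perm.sign τ = Equiv.Perm.sign ρ := by
      rw [← hρ]; simp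
    rw [← h1, hτ]
    simp [Fin.sign_cycleRange]
  · intro s
    have h2 : τ s.succ = (ρ s).succ := by
      rw [← hρ]; simp
    rw [hτ] at h2
    simp only [Equiv.Perm.mul_apply, Equiv.Perm.inv_def, Fin.cycleRange_symm_succ] at h2
    rw [← Fin.cycleRange_symm_succ (σ a) (ρ s), ← h2]
    simp

theorem cls_remove {V : Type} {n : ℕ} (e : Fin (n + 1) → Sym2 (Option V))
    (σ : Equiv.Perm (Fin (n + 1))) (a : Fin (n + 1)) :
    (-1 : ℂ) ^ (a : ℕ) • cls ((e ∘ σ) ∘ a.succAbove) =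
      ((Equiv.Perm.sign σ : ℤ) : ℂ) • (-1 : ℂ) ^ (σ a : ℕ) • cls (e ∘ (σ a).succAbove) := by
  obtain ⟨ρ, hρ, hs⟩ := exists_perm_succAbove σ a
  have : (e ∘ σ) ∘ a.succAbove = (e ∘ (σ a).succAbove) ∘ ρ := by
    ext1 s
    simp [hs]
  rw [this, cls_perm, hρ, smul_smul, smul_smul]
  congr 1
  have : ((-1 : ℂ) ^ (a : ℕ)) * (-1) ^ (a : ℕ) = 1 := by
    rw [← mul_pow]; simp
  linear_combination ((-1 : ℂ) ^ (σ a : ℕ) * (Equiv.Perm.sign σ : ℤ)) * this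

theorem cls_remove_eq {V : Type} {n : ℕ} (e : Fin (n + 1) → Sym2 (Option V))
    {a b : Fin (n + 1)} (hab : a ≠ b) (he : e a = e b) :
    (-1 : ℂ) ^ (a : ℕ) • cls (e ∘ a.succAbove) + (-1 : ℂ) ^ (b : ℕ) • cls (e ∘ b.succAbove) = 0 := by
  have h := cls_remove e (Equiv.swap a b) a
  have : e ∘ Equiv.swap a b = e := by
    ext1 c
    simp only [Function.comp_apply, Equiv.swap_apply_def]
    split_ifs <;> simp_all
  rw [this, Equiv.swap_apply_left, Equiv.Perm.sign_swap hab] at h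
  rw [h]
  simp

open Classical in
/-- The map on vertices that identifies `v` with the root. -/
def contractVertex {V : Type} (v : V) : Option V → Option {w : V // w ≠ v}
  | none => none
  | some w => if h : w = v then none else some ⟨w, h⟩

@[simp] theorem contractVertex_none {V : Type} (v : V) : contractVertex v none = none := rfl
@[simp] theorem contractVertex_self {V : Type} (v : V) : contractVertex v (some v) = none := by
  simp [contractVertex]

theorem contractVertex_eq {V : Type} {v : V} {x y : Option V}
    (h : contractVertex v x = contractVertex v y) :
    x = y ∨ s(x, y) = s(none, some v) := by
  rcases x with _ | x <;> rcases y with _ | y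
  · simp
  · by_cases hy : y = v
    · simp [hy]
    · simp [contractVertex, hy] at h
  · by_cases hx : x = v
    · simp [hx, Sym2.eq_swap]
    · simp [contractVertex, hx] at h
  · by_cases hx : x = v <;> by_cases hy : y = v <;> simp_all [contractVertex]

theorem IsForest.contract {V : Type} {n : ℕ} {e : Fin (n + 1) → Sym2 (Option V)} (h : IsForest e)
    {v : V} {a : Fin (n + 1)} (ha : e a = s(none, some v)) :
    IsForest (fun s => Sym2.map (contractVertex v) (e (a.succAbove s))) := by
  rw [isForest_iff] at h ⊢
  intro i x y hi hr
  obtain ⟨x', y', hxy⟩ : ∃ x y, e (a.succAbove i) = s(x, y) := by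
    induction h' : e (a.succAbove i) with | _ x y => exact ⟨x, y, rfl⟩
  have hai : a ≠ a.succAbove i := (Fin.succAbove_ne a i).symm
  -- vertices in the same fibre are connected through the contracted edge
  have fib : ∀ p q, contractVertex v p = contractVertex v q →
      Relation.ReflTransGen (Joined e (a.succAbove i)) p q := by
    intro p q hpq
    rcases contractVertex_eq hpq with rfl | h'
    · exact .refl
    · exact .single ⟨a, hai, by rw [ha, h']⟩
  have key : ∀ z, Relation.ReflTransGen
      (Joined (fun s => Sym2.map (contractVertex v) (e (a.succAbove s))) i) x z →
      ∀ p q, contractVertex v p = x → contractVertex v q = z →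
      Relation.ReflTransGen (Joined e (a.succAbove i)) p q := by
    intro z hz
    induction hz with
    | refl => intro p q hp hq; exact fib p q (hp.trans hq.symm)
    | tail _ hstep ih =>
      rename_i z₁ z₂ _
      intro p q hp hq
      obtain ⟨j, hj, hjz⟩ := hstep
      obtain ⟨m, m', hm⟩ : ∃ x y, e (a.succAbove j) = s(x, y) := by
        induction h' : e (a.succAbove j) with | _ x y => exact ⟨x, y, rfl⟩
      have hj' : a.succAbove j ≠ a.succAbove i := fun h => hj (Fin.succAbove_right_injective h)
      simp only [hm, Sym2.map_mk, Sym2.eq_iff] at hjz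
      rcases hjz with ⟨h1, h2⟩ | ⟨h1, h2⟩
      · exact ((ih p m hp h1).tail ⟨_, hj', hm⟩).trans (fib _ _ (h2.trans hq.symm))
      · exact ((ih p m' hp h2).tail ⟨_, hj', by rw [hm, Sym2.eq_swap]⟩).trans
          (fib _ _ (h1.trans hq.symm))
  simp only [hxy, Sym2.map_mk, Sym2.eq_iff] at hi
  rcases hi with ⟨h1, h2⟩ | ⟨h1, h2⟩
  · exact h _ x' y' hxy (key y hr x' y' h1 h2)
  · exact h _ y' x' (by rw [hxy, Sym2.eq_swap]) (key y hr y' x' h2 h1)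

open Classical in
/-- The residue at `v` of an ordered forest: if its edge at position `a` (positions start at `0`)
joins the root and `v`, this edge is contracted, later edges move up by one position, and the result
is multiplied by `(-1) ^ a`; if there is no such edge, the residue is zero. -/
def resFun {V : Type} (v : V) {n : ℕ} (e : Fin (n + 1) → Sym2 (Option V)) :
    ForestSpace {w : V // w ≠ v} n :=
  ∑ a : Fin (n + 1), if e a = s(none, some v) then
    (-1 : ℂ) ^ (a : ℕ) • cls (fun s => Sym2.map (contractVertex v) (e (a.succAbove s))) else 0

theorem resFun_eq_single {V : Type} {v : V} {n : ℕ} {e : Fin (n + 1) → Sym2 (Option V)}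
    (he : IsForest e) {a : Fin (n + 1)} (ha : e a = s(none, some v)) :
    resFun v e =
      (-1 : ℂ) ^ (a : ℕ) • cls (fun s => Sym2.map (contractVertex v) (e (a.succAbove s))) := by
  rw [resFun, Finset.sum_eq_single a, if_pos ha]
  · intro b _ hb
    rw [if_neg]
    intro h
    exact hb (he.injective (h.trans ha.symm))
  · simp

theorem resFun_eq_zero {V : Type} {v : V} {n : ℕ} {e : Fin (n + 1) → Sym2 (Option V)}
    (ha : ∀ a, e a ≠ s(none, some v)) : resFun v e = 0 := by
  rw [resFun, Finset.sum_eq_zero]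
  intro a _
  rw [if_neg (ha a)]

open Classical in
theorem resFun_perm {V : Type} (v : V) {n : ℕ} (e : Fin (n + 1) → Sym2 (Option V))
    (σ : Equiv.Perm (Fin (n + 1))) :
    resFun v (e ∘ σ) = ((Equiv.Perm.sign σ : ℤ) : ℂ) • resFun v e := by
  rw [resFun, resFun, Finset.smul_sum,
    ← Equiv.sum_comp σ (fun a => ((Equiv.Perm.sign σ : ℤ) : ℂ) • if e a = s(none, some v) then
      (-1 : ℂ) ^ (a : ℕ) • cls (fun s => Sym2.map (contractVertex v) (e (a.succAbove s))) else 0)]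
  refine Finset.sum_congr rfl fun a _ => ?_
  by_cases h : e (σ a) = s(none, some v)
  · rw [if_pos (by simpa using h), if_pos h]
    exact cls_remove (fun s => Sym2.map (contractVertex v) (e s)) σ a
  · rw [if_neg (by simpa using h), if_neg h, smul_zero]

theorem resFun_triangle_aux {V : Type} (t : V) {n : ℕ} {e₁ e₂ e₃ : Fin (n + 1) → Sym2 (Option V)}
    (h₁ : IsForest e₁) (h₂ : IsForest e₂) {a b : Fin (n + 1)}
    {u v w : Option V} (hab : a ≠ b) (t₁ : e₁ a = s(u, v) ∧ e₁ b = s(u, w))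
    (t₂ : e₂ a = s(v, w) ∧ e₂ b = s(u, v)) (t₃ : e₃ a = s(u, w) ∧ e₃ b = s(v, w))
    (hc : ∀ c, c ≠ a → c ≠ b → e₁ c = e₂ c ∧ e₂ c = e₃ c)
    (huv : s(u, v) = s(none, some t)) :
    resFun t e₁ + resFun t e₂ + resFun t e₃ = 0 := by
  have z₃ : resFun t e₃ = 0 := by
    apply resFun_eq_zero
    intro c hc'
    by_cases hca : c = a
    · subst hca
      exact hab (h₁.injective (by rw [t₁.1, t₁.2, huv, ← t₃.1, hc']))
    by_cases hcb : c = b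
    · subst hcb
      exact hab (h₂.injective (by rw [t₂.1, t₂.2, huv, ← t₃.2, hc']))
    · have := hc c hca hcb
      exact hca (h₁.injective (by rw [t₁.1, this.1, this.2, hc', huv]))
  rw [z₃, add_zero, resFun_eq_single h₁ (a := a) (by rw [t₁.1, huv]),
    resFun_eq_single h₂ (a := b) (by rw [t₂.2, huv])]
  have hk : contractVertex t u = contractVertex t v := by
    rcases Sym2.eq_iff.1 huv with ⟨rfl, rfl⟩ | ⟨rfl, rfl⟩ <;> simp
  have key := cls_remove_eq (fun s => Sym2.map (contractVertex t) (Function.update e₁ a s(u, w) s))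
    hab (by simp [Function.update_of_ne hab.symm, t₁.2])
  convert key using 3
  · congr 1
    ext1 s
    simp
  · congr 1
    ext1 s
    by_cases hs : b.succAbove s = a
    · simp [hs, t₂.1, hk]
    · have := hc _ hs (Fin.succAbove_ne b s)
      simp [hs, this.1]

theorem resFun_triangle {V : Type} (t : V) {n : ℕ} (e₁ e₂ e₃ : Fin (n + 1) → Sym2 (Option V))
    (h₁ : IsForest e₁) (h₂ : IsForest e₂) (h₃ : IsForest e₃) (a b : Fin (n + 1))
    (u v w : Option V) (hab : a ≠ b) (t₁ : e₁ a = s(u, v) ∧ e₁ b = s(u, w))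
    (t₂ : e₂ a = s(v, w) ∧ e₂ b = s(u, v)) (t₃ : e₃ a = s(u, w) ∧ e₃ b = s(v, w))
    (hc : ∀ c, c ≠ a → c ≠ b → e₁ c = e₂ c ∧ e₂ c = e₃ c) :
    resFun t e₁ + resFun t e₂ + resFun t e₃ = 0 := by
  by_cases huv : s(u, v) = s(none, some t)
  · exact resFun_triangle_aux t h₁ h₂ hab t₁ t₂ t₃ hc huv
  have sw : ∀ x y : Option V, s(x, y) = s(y, x) := fun x y => Sym2.eq_swap
  by_cases hvw : s(v, w) = s(none, some t)
  · have := resFun_triangle_aux (e₃ := e₁) (u := v) (v := w) (w := u) t h₂ h₃ hab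
      ⟨t₂.1, by rw [t₂.2, sw]⟩ ⟨by rw [t₃.1, sw], t₃.2⟩ ⟨by rw [t₁.1, sw], by rw [t₁.2, sw]⟩
      (fun c ha hb => ⟨(hc c ha hb).2, by rw [← (hc c ha hb).2, (hc c ha hb).1]⟩) hvw
    rw [← this]; abel
  by_cases huw : s(u, w) = s(none, some t)
  · have := resFun_triangle_aux (e₃ := e₂) (u := w) (v := u) (w := v) t h₃ h₁ hab
      ⟨by rw [t₃.1, sw], by rw [t₃.2, sw]⟩ ⟨t₁.1, by rw [t₁.2, sw]⟩ ⟨by rw [t₂.1, sw], t₂.2⟩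
      (fun c ha hb => ⟨by rw [← (hc c ha hb).2, (hc c ha hb).1], (hc c ha hb).1⟩)
      (by rw [sw, huw])
    rw [← this]; abel
  rw [resFun, resFun, resFun, ← Finset.sum_add_distrib, ← Finset.sum_add_distrib]
  refine Finset.sum_eq_zero fun c _ => ?_
  by_cases hca : c = a
  · subst hca
    simp [t₁.1, t₂.1, t₃.1, huv, hvw, huw, -Sym2.eq]
  by_cases hcb : c = b
  · subst hcb
    simp [t₁.2, t₂.2, t₃.2, huv, hvw, huw, -Sym2.eq]
  have hcc := hc c hca hcb
  by_cases hx : e₃ c = s(none, some t)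
  · have hx₂ : e₂ c = s(none, some t) := by rw [hcc.2, hx]
    have hx₁ : e₁ c = s(none, some t) := by rw [hcc.1, hx₂]
    rw [if_pos hx, if_pos hx₁, if_pos hx₂, ← smul_add, ← smul_add]
    obtain ⟨a', rfl⟩ := Fin.exists_succAbove_eq (Ne.symm hca)
    obtain ⟨b', rfl⟩ := Fin.exists_succAbove_eq (Ne.symm hcb)
    rw [cls_triangle (h₁.contract hx₁) (h₂.contract hx₂) (h₃.contract hx) (a := a') (b := b')
      (u := contractVertex t u) (v := contractVertex t v) (w := contractVertex t w)
      (fun h => hab (by rw [h])) (by simp [t₁.1, t₁.2]) (by simp [t₂.1, t₂.2])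
      (by simp [t₃.1, t₃.2]), smul_zero]
    intro d hda hdb
    have := hc (c.succAbove d) (fun h => hda (Fin.succAbove_right_injective h))
      (fun h => hdb (Fin.succAbove_right_injective h))
    simp [this.1, this.2]
  · have hx₂ : e₂ c ≠ s(none, some t) := by rwa [hcc.2]
    have hx₁ : e₁ c ≠ s(none, some t) := by rwa [hcc.1]
    rw [if_neg hx, if_neg hx₁, if_neg hx₂]; simp

theorem resFun_swap {V : Type} (v : V) {n : ℕ} (e : Fin (n + 1) → Sym2 (Option V))
    (_ : IsForest e) (a b : Fin (n + 1)) (hab : a ≠ b) :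
    resFun v e + resFun v (e ∘ Equiv.swap a b) = 0 := by
  rw [resFun_perm, Equiv.Perm.sign_swap hab]; simp

/-- The residue at the vertex `v` as a linear map; its values are forests on the remaining
vertices. -/
def res {V : Type} (v : V) : (p : ℕ) → ForestSpace V p →ₗ[ℂ] ForestSpace {w : V // w ≠ v} (p - 1)
  | 0 => 0
  | _ + 1 => ForestSpace.lift (resFun v) (resFun_swap v) (resFun_triangle v)

theorem ForestSpace.res_cls {V : Type} (v : V) {n : ℕ} {e : Fin (n + 1) → Sym2 (Option V)}
    (he : IsForest e) : res v (n + 1) (cls e) = resFun v e :=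
  ForestSpace.lift_cls (resFun v) (resFun_swap v) (resFun_triangle v) he

theorem isForest_map {V : Type} (σ : Equiv.Perm V) {p : ℕ} {e : Fin p → Sym2 (Option V)}
    (h : IsForest e) : IsForest (fun s => Sym2.map (Option.map σ) (e s)) := by
  rw [isForest_iff] at h ⊢
  intro i x y hi hr
  have hσ' : ∀ x : Option V, Option.map (σ⁻¹ : Equiv.Perm V) (Option.map σ x) = x := by
    intro x; cases x <;> simp
  have pull : ∀ {j x y}, Sym2.map (Option.map σ) (e j) = s(x, y) →
      e j = s(Option.map (σ⁻¹ : Equiv.Perm V) x, Option.map (σ⁻¹ : Equiv.Perm V) y) := by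
    intro j x y hj
    have := congrArg (Sym2.map (Option.map (σ⁻¹ : Equiv.Perm V))) hj
    rw [Sym2.map_map] at this
    rw [← Sym2.map_mk, ← this]
    have hid : (Option.map (σ⁻¹ : Equiv.Perm V) ∘ Option.map σ) = id := by
      funext x; exact hσ' x
    rw [hid, Sym2.map_id, id]
  refine h i _ _ (pull hi) ?_
  refine Relation.ReflTransGen.lift (Option.map (σ⁻¹ : Equiv.Perm V)) ?_ _ _ hr
  rintro a b ⟨j, hj, hab⟩
  exact ⟨j, hj, pull hab⟩

/-- The action of permutations of `V` on the space of forests. -/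
def relabel {V : Type} (σ : Equiv.Perm V) (p : ℕ) : ForestSpace V p →ₗ[ℂ] ForestSpace V p :=
  ForestSpace.lift (fun e => cls fun s => Sym2.map (Option.map σ) (e s))
    (fun e _ a b hab => by
      have := cls_swap (fun s => Sym2.map (Option.map σ) (e s)) hab
      rw [← eq_neg_iff_add_eq_zero, ← neg_eq_iff_eq_neg, ← this]; rfl)
    (fun e₁ e₂ e₃ h₁ h₂ h₃ a b u v w hab t₁ t₂ t₃ hc =>
      cls_triangle (isForest_map σ h₁) (isForest_map σ h₂) (isForest_map σ h₃) hab
        (u := Option.map σ u) (v := Option.map σ v) (w := Option.map σ w)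
        (by simp [t₁.1, t₁.2]) (by simp [t₂.1, t₂.2]) (by simp [t₃.1, t₃.2])
        (fun c ha hb => by simp [(hc c ha hb).1, (hc c ha hb).2]))

theorem relabel_cls {V : Type} (σ : Equiv.Perm V) {p : ℕ} (e : Fin p → Sym2 (Option V))
    (he : IsForest e) :
    relabel σ p (cls e) = cls fun s => Sym2.map (Option.map σ) (e s) :=
  ForestSpace.lift_cls _ _ _ he

theorem ForestSpace.hom_ext {V : Type} {p : ℕ} {M : Type} [AddCommGroup M] [Module ℂ M]
    {f g : ForestSpace V p →ₗ[ℂ] M} (h : ∀ e, IsForest e → f (cls e) = g (cls e)) : f = g := by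
  apply Submodule.linearMap_qext
  apply Finsupp.lhom_ext'
  rintro ⟨e, he⟩
  apply LinearMap.ext_ring
  have := h e he
  rw [cls, dif_pos he] at this
  exact this

theorem relabel_mul {V : Type} (σ τ : Equiv.Perm V) {p : ℕ} (x : ForestSpace V p) :
    relabel (σ * τ) p x = relabel σ p (relabel τ p x) := by
  suffices h : relabel (σ * τ) p = relabel σ p ∘ₗ relabel τ p by rw [h]; rfl
  apply ForestSpace.hom_ext
  intro e he
  rw [LinearMap.comp_apply, relabel_cls _ _ he, relabel_cls _ _ he,
    relabel_cls _ _ (isForest_map τ he)]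
  congr 1
  funext s
  rw [Sym2.map_map]
  congr 1
  funext x
  cases x <;> simp

/-- The variables `t^{(i)}_j`, `j = 1, …, k_i`, with `j` counted from `0`. -/
abbrev Var {r : ℕ} (k : Fin r → ℕ) : Type := Σ i : Fin r, Fin (k i)

/-- The number `|k|`. -/
abbrev size {r : ℕ} (k : Fin r → ℕ) : ℕ := ∑ i, k i

/-- The group `G_k`, permuting variables with the same upper index. -/
abbrev ColorGroup {r : ℕ} (k : Fin r → ℕ) : Type := ∀ i, Equiv.Perm (Fin (k i))

abbrev ColorGroup.toPerm {r : ℕ} {k : Fin r → ℕ} (π : ColorGroup k) : Equiv.Perm (Var k) :=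
  Equiv.Perm.sigmaCongrRight π

/-- The space `𝒜(k)`: the skew-invariant part of `𝒜^{|k|}` on the variables `t^{(i)}_j`. -/
def skewForests {r : ℕ} (k : Fin r → ℕ) : Submodule ℂ (ForestSpace (Var k) (size k)) where
  carrier := {x | ∀ π : ColorGroup k,
    relabel π.toPerm (size k) x = ((Equiv.Perm.sign π.toPerm : ℤ) : ℂ) • x}
  add_mem' {x y} hx hy π := by rw [map_add, hx π, hy π, smul_add]
  zero_mem' π := by simp
  smul_mem' c x hx π := by rw [map_smul, hx π, smul_comm]

/-- Antisymmetrization. -/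
def asym {r : ℕ} {k : Fin r → ℕ} (x : ForestSpace (Var k) (size k)) :
    ForestSpace (Var k) (size k) :=
  ∑ π : ColorGroup k, ((Equiv.Perm.sign π.toPerm : ℤ) : ℂ) • relabel π.toPerm (size k) x

theorem asym_mem {r : ℕ} {k : Fin r → ℕ} (x : ForestSpace (Var k) (size k)) :
    asym x ∈ skewForests k := by
  intro π
  rw [asym, map_sum, Finset.smul_sum,
    ← Equiv.sum_comp (Equiv.mulLeft π) (fun ρ : ColorGroup k =>
      ((Equiv.Perm.sign π.toPerm : ℤ) : ℂ) • ((Equiv.Perm.sign ρ.toPerm : ℤ) : ℂ) •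
        relabel ρ.toPerm (size k) x)]
  refine Finset.sum_congr rfl fun ρ _ => ?_
  have h : (π * ρ).toPerm = π.toPerm * ρ.toPerm := by
    simp [ColorGroup.toPerm]
  have hs : ((Equiv.Perm.sign π.toPerm : ℤ) : ℂ) * ((Equiv.Perm.sign π.toPerm : ℤ) : ℂ) = 1 := by
    rcases Int.units_eq_one_or (Equiv.Perm.sign π.toPerm) with h | h <;> simp [h]
  rw [map_smul, Equiv.coe_mulLeft, h, relabel_mul, Equiv.Perm.sign_mul, smul_smul]
  congr 1
  push_cast
  rw [← mul_assoc, hs, one_mul]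

/-- The residues at `v 0`, `v 1`, …, in this order, end in a multiple of the forest without edges;
the value is the factor. -/
def iterRes : (n : ℕ) → (V : Type) → (Fin n ↪ V) → ForestSpace V n →ₗ[ℂ] ℂ
  | 0, _, _ => ForestSpace.lift (fun _ => 1) (fun _ _ a => a.elim0) (fun _ _ _ _ _ _ a => a.elim0)
  | n + 1, V, v =>
      iterRes n {w : V // w ≠ v 0}
        ⟨fun s => ⟨v s.succ, fun h => Fin.succ_ne_zero s (v.injective h)⟩,
          fun _ _ h => Fin.succ_injective n (v.injective (congrArg Subtype.val h))⟩ ∘ₗ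
      res (v 0) (n + 1)

/-- The path `z - v 0 - v 1 - ⋯` with its edges in this order. -/
def path {V : Type} {n : ℕ} (v : Fin n → V) (s : Fin n) : Sym2 (Option V) :=
  s(if h : (s : ℕ) = 0 then none else some (v ⟨s - 1, by lia⟩), some (v s))

theorem isForest_path {V : Type} {n : ℕ} (v : Fin n ↪ V) : IsForest (path v) := by
  rw [isForest_iff]
  intro i x y hi hr
  let P : Option V → Prop := fun o => ∀ w, o = some w → ∃ s, s < i ∧ v s = w
  have inv : ∀ a b, Joined (path v) i a b → P a → P b := by
    rintro a b ⟨j, hj, hab⟩ ha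
    rcases lt_or_gt_of_ne hj with hlt | hgt
    · rw [path, Sym2.eq_iff] at hab
      rcases hab with ⟨h1, rfl⟩ | ⟨rfl, h2⟩
      · intro w hw
        exact ⟨j, hlt, by simpa using hw⟩
      · intro w hw
        split_ifs at hw with h0
        refine ⟨⟨j - 1, by lia⟩, ?_, by simpa using hw⟩
        rw [Fin.lt_def] at hlt ⊢
        simp only
        lia
    · have h0 : (j : ℕ) ≠ 0 := by rw [Fin.lt_def] at hgt; lia
      rw [path, dif_neg h0, Sym2.eq_iff] at hab
      rcases hab with ⟨rfl, rfl⟩ | ⟨rfl, rfl⟩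
      · obtain ⟨s, hs, hs'⟩ := ha _ rfl
        have := v.injective hs'
        rw [this, Fin.lt_def] at hs
        rw [Fin.lt_def] at hgt
        simp at hs; lia
      · obtain ⟨s, hs, hs'⟩ := ha _ rfl
        have := v.injective hs'
        exact absurd (this ▸ hs) (not_lt.2 hgt.le)
  have inv' : ∀ a b, Relation.ReflTransGen (Joined (path v) i) a b → P a → P b := by
    intro a b h ha
    induction h with
    | refl => exact ha
    | tail _ h ih => exact inv _ _ h ih
  have hend : ¬ P (some (v i)) := by
    intro h
    obtain ⟨s, hs, hs'⟩ := h _ rfl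
    exact absurd hs (by rw [v.injective hs']; exact lt_irrefl _)
  have hstart : P (if h : (i : ℕ) = 0 then none else some (v ⟨i - 1, by lia⟩)) := by
    intro w hw
    split_ifs at hw with h0
    refine ⟨⟨i - 1, by lia⟩, ?_, by simpa using hw⟩
    rw [Fin.lt_def]
    simp only
    lia
  have hsym : Relation.ReflTransGen (Joined (path v) i) y x := by
    clear hi
    induction hr with
    | refl => exact .refl
    | tail _ h ih => exact ih.head h.symm
  rw [path, Sym2.eq_iff] at hi
  rcases hi with ⟨rfl, rfl⟩ | ⟨rfl, rfl⟩
  · exact hend (inv' _ _ hr hstart)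
  · exact hend (inv' _ _ hsym hstart)

theorem iterRes_path : ∀ (n : ℕ) (V : Type) (v v' : Fin n ↪ V),
    iterRes n V v (cls (path v')) = open Classical in if v = v' then 1 else 0 := by
  classical
  intro n
  induction n with
  | zero =>
    intro V v v'
    rw [if_pos (by ext i; exact i.elim0), iterRes, ForestSpace.lift_cls _ _ _ (isForest_path v')]
  | succ n ih =>
    intro V v v'
    rw [iterRes, LinearMap.comp_apply, ForestSpace.res_cls _ (isForest_path v')]
    by_cases h0 : v' 0 = v 0
    · rw [resFun_eq_single (isForest_path v') (a := 0) (by simp [path, h0])]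
      let w' : Fin n ↪ {w : V // w ≠ v 0} :=
        ⟨fun s => ⟨v' s.succ, fun h => Fin.succ_ne_zero s (v'.injective (h.trans h0.symm))⟩,
          fun _ _ h => Fin.succ_injective n (v'.injective (congrArg Subtype.val h))⟩
      have hp : (fun s => Sym2.map (contractVertex (v 0)) (path v' ((0 : Fin (n + 1)).succAbove s)))
          = path w' := by
        funext s
        have hne : v' s.succ ≠ v 0 := (w' s).2
        have e1 : path v' ((0 : Fin (n + 1)).succAbove s) =
            s(some (v' s.castSucc), some (v' s.succ)) := by
          rw [Fin.succAbove_zero, path, dif_neg (by simp)]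
          rfl
        rw [e1, Sym2.map_mk, path]
        refine congrArg₂ (fun x y => s(x, y)) ?_ ?_
        · by_cases hs : (s : ℕ) = 0
          · have : s.castSucc = 0 := by ext; simp [hs]
            rw [dif_pos hs, this, h0, contractVertex_self]
          · have : s.castSucc = Fin.succ ⟨s - 1, by lia⟩ := by
              ext; simp; lia
            rw [dif_neg hs, this, contractVertex]
            exact dif_neg (w' ⟨s - 1, by lia⟩).2
        · simp only [contractVertex, dif_neg hne]
          rfl
      rw [hp, map_smul]
      erw [ih _ _ w']
      simp only [Fin.val_zero, pow_zero, one_smul]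
      congr 1
      rw [eq_iff_iff]
      constructor
      · intro h
        ext s
        refine Fin.cases h0.symm (fun s => ?_) s
        exact congrArg Subtype.val (DFunLike.congr_fun h s)
      · rintro rfl
        rfl
    · rw [if_neg (by rintro rfl; exact h0 rfl), resFun_eq_zero, map_zero]
      intro a ha
      rw [path, Sym2.eq_iff] at ha
      rcases ha with ⟨h1, h2⟩ | ⟨h1, h2⟩
      · split_ifs at h1 with h
        have : a = 0 := by ext; simpa using h
        subst this
        exact h0 (by simpa using h2)
      · simp at h2

/-- The last variable `t^{(i)}_{k_i}` of the `i`-th kind, if there is any. -/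
abbrev lastVar {r : ℕ} (k : Fin r → ℕ) (i : Fin r) (hi : 0 < k i) : Var k :=
  ⟨i, ⟨k i - 1, Nat.sub_one_lt_of_lt hi⟩⟩

/-- The `k`-multiindices. -/
abbrev Multiindex {r : ℕ} (k : Fin r → ℕ) : Type :=
  {J : Fin (size k) → Fin r // ∀ i, (Finset.univ.filter fun s => J s = i).card = k i}

theorem Multiindex.rank_lt {r : ℕ} {k : Fin r → ℕ} (J : Multiindex k) (s : Fin (size k)) :
    (Finset.univ.filter fun t => t < s ∧ J.1 t = J.1 s).card < k (J.1 s) := by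
  rw [← J.2 (J.1 s)]
  apply Finset.card_lt_card
  rw [Finset.ssubset_iff_of_subset (by intro t; simp)]
  exact ⟨s, by simp, by simp⟩

/-- The variable `t^{(J(s))}_{c(s)}`: here `c` is increasing from each `J⁻¹(i)` onto the index set
of the `t^{(i)}_j`. -/
def Multiindex.var {r : ℕ} {k : Fin r → ℕ} (J : Multiindex k) : Fin (size k) ↪ Var k where
  toFun s := ⟨J.1 s, ⟨(Finset.univ.filter fun t => t < s ∧ J.1 t = J.1 s).card, J.rank_lt s⟩⟩
  inj' := by
    have key : ∀ s s', s < s' → J.1 s = J.1 s' →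
        (Finset.univ.filter fun t => t < s ∧ J.1 t = J.1 s).card <
        (Finset.univ.filter fun t => t < s' ∧ J.1 t = J.1 s').card := by
      intro s s' hs hJ
      apply Finset.card_lt_card
      rw [Finset.ssubset_iff_of_subset]
      · exact ⟨s, by simp [hs, hJ], by simp⟩
      · intro t
        simp only [Finset.mem_filter, Finset.mem_univ, true_and]
        exact fun h => ⟨h.1.trans hs, h.2.trans hJ⟩
    intro s s' h
    rw [Sigma.mk.injEq] at h
    obtain ⟨h1, h2⟩ := h
    have h3 := (Fin.heq_ext_iff (congrArg k h1)).1 h2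
    simp only at h3
    rcases lt_trichotomy s s' with hlt | heq | hgt
    · exact absurd h3 (key _ _ hlt h1).ne
    · exact heq
    · exact absurd h3 (key _ _ hgt h1.symm).ne'

/-- The sign of a multiindex: the parity of the number of transpositions of neighbours that are
needed to sort the list `J(1), J(2), …`, that is, of its number of inversions. -/
def Multiindex.sgn {r : ℕ} {k : Fin r → ℕ} (J : Multiindex k) : ℂ :=
  (-1) ^ (Finset.univ.filter fun q : Fin (size k) × Fin (size k) =>
    q.1 < q.2 ∧ J.1 q.2 < J.1 q.1).card

theorem Multiindex.sgn_mul_self {r : ℕ} {k : Fin r → ℕ} (J : Multiindex k) :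
    J.sgn * J.sgn = 1 := by
  rw [Multiindex.sgn, ← mul_pow]; simp

/-- The word of the monomial `f̃_J`. -/
def Multiindex.word {r : ℕ} {k : Fin r → ℕ} (J : Multiindex k) : FreeMonoid (Fin r) :=
  FreeMonoid.ofList (List.ofFn J.1).reverse

/-- The monomial `f̃_J = f̃_{J(|k|)} ⋯ f̃_{J(1)}` in the free algebra. -/
def Multiindex.monomial {r : ℕ} {k : Fin r → ℕ} (J : Multiindex k) : FreeAlgebra ℂ (Fin r) :=
  ((List.ofFn fun s => FreeAlgebra.ι ℂ (J.1 s)).reverse).prod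

/-- The part `U[k]` of degree `k` of the free algebra. -/
def freePart {r : ℕ} (k : Fin r → ℕ) : Submodule ℂ (FreeAlgebra ℂ (Fin r)) :=
  Submodule.span ℂ (Set.range (Multiindex.monomial (k := k)))

/-- The functional `⟨f̃_J, ·⟩` on `𝒜(k)`. -/
def monomialPairing {r : ℕ} {k : Fin r → ℕ} (J : Multiindex k) : skewForests k →ₗ[ℂ] ℂ :=
  J.sgn • (iterRes (size k) (Var k) J.var ∘ₗ (skewForests k).subtype)

/-- The pairing of the free algebra with `𝒜(k)`: linear, `⟨f̃_J, T⟩` for monomials of degree `k`,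
and zero on monomials of other degrees. -/
def pairing {r : ℕ} (k : Fin r → ℕ) : FreeAlgebra ℂ (Fin r) →ₗ[ℂ] skewForests k →ₗ[ℂ] ℂ :=
  ∑ J : Multiindex k,
    ((FreeAlgebra.basisFreeMonoid ℂ (Fin r)).coord J.word).smulRight (monomialPairing J)

theorem Multiindex.monomial_eq {r : ℕ} {k : Fin r → ℕ} (J : Multiindex k) :
    J.monomial = FreeAlgebra.basisFreeMonoid ℂ (Fin r) J.word := by
  have key : ∀ l : List (Fin r), (l.map (FreeAlgebra.ι ℂ)).prod =
      FreeAlgebra.basisFreeMonoid ℂ (Fin r) (FreeMonoid.ofList l) := by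
    intro l
    have h : ∀ l : List (Fin r), FreeAlgebra.equivMonoidAlgebraFreeMonoid
        (l.map (FreeAlgebra.ι ℂ)).prod = MonoidAlgebra.of ℂ (FreeMonoid (Fin r))
          (FreeMonoid.ofList l) := by
      intro l
      induction l with
      | nil => simp [MonoidAlgebra.one_def]
      | cons a l ih =>
        rw [List.map_cons, List.prod_cons, map_mul, ih, FreeMonoid.ofList_cons, map_mul]
        simp [FreeAlgebra.equivMonoidAlgebraFreeMonoid]
    simp only [FreeAlgebra.basisFreeMonoid, Module.Basis.map_apply]
    rw [LinearEquiv.eq_symm_apply]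
    simp only [LinearEquiv.trans_apply, AlgEquiv.toLinearEquiv_apply, h]
    simp
  rw [Multiindex.monomial, Multiindex.word, ← key, List.map_reverse, List.map_ofFn]
  rfl

theorem pairing_monomial {r : ℕ} {k : Fin r → ℕ} (J : Multiindex k) (T : skewForests k) :
    pairing k J.monomial T = monomialPairing J T := by
  rw [J.monomial_eq, pairing, LinearMap.sum_apply, LinearMap.sum_apply, Finset.sum_eq_single J]
  · simp
  · intro J' _ hne
    have : J.word ≠ J'.word := by
      intro h
      apply hne
      rw [Multiindex.word, Multiindex.word] at h
      have h' := List.reverse_injective (FreeMonoid.ofList.injective h)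
      exact (Subtype.ext (List.ofFn_injective h')).symm
    simp [this]
  · simp

/-- The element `f̃_J^*` of `𝒜(k)`, dual to the monomials by
`monomialPairing_dualMonomial`. -/
def dualMonomial {r : ℕ} {k : Fin r → ℕ} (J : Multiindex k) : skewForests k :=
  J.sgn • ⟨asym (cls (path J.var)), asym_mem _⟩

theorem path_map {V : Type} {n : ℕ} (v : Fin n ↪ V) (σ : Equiv.Perm V) :
    (fun s => Sym2.map (Option.map σ) (path v s)) = path (v.trans σ.toEmbedding) := by
  funext s
  rw [path, path, Sym2.map_mk]
  refine congrArg₂ (fun x y => s(x, y)) ?_ rfl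
  split_ifs <;> rfl

theorem monomialPairing_dualMonomial {r : ℕ} {k : Fin r → ℕ} (J J' : Multiindex k) :
    monomialPairing J (dualMonomial J') = if J = J' then 1 else 0 := by
  classical
  have h1 : monomialPairing J (dualMonomial J') = J.sgn * (J'.sgn *
      ∑ π : ColorGroup k, ((Equiv.Perm.sign π.toPerm : ℤ) : ℂ) *
        if J.var = J'.var.trans π.toPerm.toEmbedding then 1 else 0) := by
    simp only [monomialPairing, dualMonomial, LinearMap.smul_apply, LinearMap.comp_apply,
      Submodule.subtype_apply, asym, map_smul, map_sum, smul_eq_mul]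
    rw [mul_left_comm]
    refine congrArg (fun c : ℂ => J.sgn * c) (congrArg (fun c : ℂ => J'.sgn * c)
      (Finset.sum_congr rfl fun π _ => ?_))
    rw [relabel_cls _ _ (isForest_path _), path_map]
    congr 1
    convert iterRes_path _ _ _ _
  have h2 : ∀ π : ColorGroup k, J.var = J'.var.trans π.toPerm.toEmbedding ↔ J = J' ∧ π = 1 := by
    intro π
    constructor
    · intro h
      have hJ : J = J' := by
        apply Subtype.ext
        funext s
        exact congrArg Sigma.fst (DFunLike.congr_fun h s)
      refine ⟨hJ, ?_⟩
      subst hJ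
      have hsurj : Function.Surjective J.var := by
        have := (Fintype.bijective_iff_injective_and_card J.var).2 ⟨J.var.injective, by simp⟩
        exact this.2
      funext i
      ext1 j
      obtain ⟨s, hs⟩ := hsurj ⟨i, j⟩
      have := DFunLike.congr_fun h s
      simp only [Function.Embedding.trans_apply, hs, Equiv.coe_toEmbedding] at this
      simpa [ColorGroup.toPerm] using this.symm
    · rintro ⟨rfl, rfl⟩
      ext1 s
      simp [ColorGroup.toPerm]
  rw [h1]
  simp only [h2]
  by_cases hJ : J = J'
  · subst hJ
    simp [J.sgn_mul_self, ColorGroup.toPerm]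
  · simp [hJ]

/-- The canonical element `Ω_k` of `𝒜(k) ⊗ U[k]`: the sum of `b^* ⊗ b` over the monomial basis. -/
def canonicalElement {r : ℕ} (k : Fin r → ℕ) : skewForests k ⊗[ℂ] freePart k :=
  ∑ J : Multiindex k, dualMonomial J ⊗ₜ ⟨J.monomial, Submodule.subset_span ⟨J, rfl⟩⟩

/-- As a map from the dual of `𝒜(k)` to `U[k]`, the canonical element inverts the pairing. -/
theorem pairing_canonicalElement {r : ℕ} (k : Fin r → ℕ) (x : freePart k) :
    TensorProduct.lid ℂ _ ((pairing k x.1).rTensor (freePart k) (canonicalElement k)) = x := by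
  obtain ⟨x, hx⟩ := x
  apply Subtype.ext
  induction hx using Submodule.span_induction with
  | mem x h =>
    obtain ⟨J, rfl⟩ := h
    simp [canonicalElement, pairing_monomial, monomialPairing_dualMonomial]
  | zero => simp
  | add x y hx hy ihx ihy =>
    simp only [map_add, LinearMap.rTensor_add, LinearMap.add_apply, Submodule.coe_add] at ihx ihy ⊢
    rw [ihx, ihy]
  | smul c x hx ih =>
    simp only [map_smul, LinearMap.rTensor_smul, LinearMap.smul_apply, Submodule.coe_smul] at ih ⊢
    rw [ih]

/-! ### Simple Lie algebras

`B : LieAlgebra.Basis (Fin r) H` consists of Chevalley generators `B.e i`, `B.h i`, `B.f i` and the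
Cartan matrix `B.A`, with `B.A j i` the value of the simple root `α_j = B.baseSupp j` at `B.h i`. -/

section LieAlgebraPart

variable {g : Type*} [LieRing g] [LieAlgebra ℂ g] {H : LieSubalgebra ℂ g}

/-- The subalgebra `n` generated by the `f_i`. -/
def lowerPart {r : ℕ} (B : LieAlgebra.Basis (Fin r) H) : LieSubalgebra ℂ g :=
  LieSubalgebra.lieSpan ℂ g (Set.range B.f)

/-- The enveloping algebra `U(n)`. -/
abbrev UEnv {r : ℕ} (B : LieAlgebra.Basis (Fin r) H) : Type _ :=
  UniversalEnvelopingAlgebra ℂ (lowerPart B)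

/-- The quotient map `q` from the free algebra to `U(n)`. -/
def toUEnv {r : ℕ} (B : LieAlgebra.Basis (Fin r) H) : FreeAlgebra ℂ (Fin r) →ₐ[ℂ] UEnv B :=
  FreeAlgebra.lift ℂ fun i => UniversalEnvelopingAlgebra.ι ℂ
    (⟨B.f i, LieSubalgebra.subset_lieSpan ⟨i, rfl⟩⟩ : lowerPart B)

/-- The two-sided ideal of the Serre relations `ad(f̃_i)^{1 - α_j(h_i)}(f̃_j)`, `i ≠ j`. -/
def serreIdeal {r : ℕ} (B : LieAlgebra.Basis (Fin r) H) : TwoSidedIdeal (FreeAlgebra ℂ (Fin r)) :=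
  TwoSidedIdeal.span {x | ∃ i j : Fin r, i ≠ j ∧
    x = (fun y => FreeAlgebra.ι ℂ i * y - y * FreeAlgebra.ι ℂ i)^[(1 - B.A j i).toNat]
      (FreeAlgebra.ι ℂ j)}

/-- The canonical element `Ω^g_k`, the image of `Ω_k` under `id ⊗ q`. -/
def canonicalElementLie {r : ℕ} (B : LieAlgebra.Basis (Fin r) H) (k : Fin r → ℕ) :
    skewForests k ⊗[ℂ] UEnv B :=
  ((toUEnv B).toLinearMap ∘ₗ (freePart k).subtype).lTensor (skewForests k) (canonicalElement k)

variable [H.IsCartanSubalgebra]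

/-- The positive roots: roots that are combinations of simple roots with coefficients in `ℕ`. -/
abbrev PositiveRoot {r : ℕ} (B : LieAlgebra.Basis (Fin r) H) : Type _ :=
  {β : LieModule.Weight ℂ H g // β.IsNonZero ∧
    ∃ k : Fin r → ℕ, ∀ x : H, β x = ∑ i, (k i : ℂ) * B.baseSupp i x}

/-- The coefficients of a positive root in the simple roots (unique, because the latter are linearly
independent). -/
def PositiveRoot.degree {r : ℕ} {B : LieAlgebra.Basis (Fin r) H} (β : PositiveRoot B) :
    Fin r → ℕ :=
  β.2.2.choose

theorem PositiveRoot.degree_spec {r : ℕ} {B : LieAlgebra.Basis (Fin r) H} (β : PositiveRoot B)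
    (x : H) : β.1 x = ∑ i, (β.degree i : ℂ) * B.baseSupp i x :=
  β.2.2.choose_spec x

/-- The choices that a Poincaré–Birkhoff–Witt basis of `U(n)` depends on. The root vectors in `n` of
the positive root `β` span the root space of `-β`. -/
structure PBWChoices {r : ℕ} (B : LieAlgebra.Basis (Fin r) H) (m : ℕ) where
  /-- The linear ordering `β_1 < ⋯ < β_m` of all the positive roots. -/
  root : Fin m ≃ PositiveRoot B
  /-- The generators `F_{β_j}`. -/
  F : Fin m → lowerPart B
  F_mem : ∀ j, (F j : g) ∈ LieAlgebra.rootSpace H (-((root j).1 : H → ℂ))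
  F_ne_zero : ∀ j, F j ≠ 0

namespace PBWChoices

variable {r m : ℕ} {B : LieAlgebra.Basis (Fin r) H} (D : PBWChoices B m)

/-- The degree `k^{(j)}` of `F_{β_j}`. -/
abbrev degree (j : Fin m) : Fin r → ℕ := (D.root j).degree

/-- The monomial `F^p = F_{β_1}^{p_1} ⋯ F_{β_m}^{p_m}` in `U(n)`. -/
def monomial (p : Fin m → ℕ) : UEnv B :=
  (List.ofFn fun j => UniversalEnvelopingAlgebra.ι ℂ (D.F j) ^ p j).prod

open Classical in
/-- The coefficient of `F^p` in the expansion with respect to the basis `(F^p)_p` of `U(n)`. That this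
family is a basis is the Poincaré–Birkhoff–Witt theorem, so the second case does not occur. -/
def coeff (p : Fin m → ℕ) : UEnv B →ₗ[ℂ] ℂ :=
  if h : LinearIndependent ℂ D.monomial ∧ ⊤ ≤ Submodule.span ℂ (Set.range D.monomial) then
    (Module.Basis.mk h.1 h.2).coord p
  else 0

/-- The component `T_p ∈ 𝒜(k)` of the expansion `Ω^g_k = ∑_p T_p ⊗ F^p`. -/
def pbwComponent (k : Fin r → ℕ) (p : Fin m → ℕ) : skewForests k :=
  TensorProduct.rid ℂ _ ((D.coeff p).lTensor (skewForests k) (canonicalElementLie B k))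

/-- The element `η_{β_j} ∈ 𝒜(k^{(j)})`, that is, the component `T_p` at `F^p = F_{β_j}`. -/
def eta (j : Fin m) : skewForests (D.degree j) :=
  D.pbwComponent (D.degree j) (Pi.single j 1)

end PBWChoices

end LieAlgebraPart

end CanElt

end

/-!
An element of `𝒜(k)`, `k ≠ 0`, is determined by its residues, because the pairing with `U[k]` has no
kernel in `𝒜(k)`.

Let `V` have `n` elements. An `n`-forest on `V ∪ {z}` is a spanning tree. The classes of the paths
`z - v 0 - ⋯ - v (n - 1)` span the space of `n`-forests (`span_path_eq_top`). Indeed, if the root has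
two edges `zv` and `zw`, the triangle relation with `u = z` expresses the tree through two trees with
one edge less at the root; and if the root has a single edge `zt`, the tree arises from a tree on
`V ∖ {t}`, with `t` in the role of the root, and induction on `n` applies
(`cls_mem_of_rootDegree_eq_one`). Since iterated residues separate the paths (`iterRes_path`), they
separate the elements of the space (`eq_zero_of_iterRes_eq_zero`).

Now let `δ` be the difference of the two elements of `𝒜(k)`. Its residues at the last variables
vanish. By skew-invariance, each iterated residue of `δ` equals, up to sign, one whose first step is
the residue at a last variable (`iterRes_relabel` compares residues before and after a permutation of
the variables). Hence all iterated residues of `δ` vanish, and `δ = 0`. The degree of a root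
is not zero, so at least one residue is taken.
-/

noncomputable section

namespace CanElt

/-! ### Spanning trees -/

theorem reachable_map {V W : Type} {p : ℕ} {e : Fin p → Sym2 V} {G : SimpleGraph W} (f : V → W)
    (h : ∀ a x y, e a = s(x, y) → G.Reachable (f x) (f y)) {x y : V}
    (hxy : (SimpleGraph.fromEdgeSet (Set.range e)).Reachable x y) : G.Reachable (f x) (f y) := by
  rw [SimpleGraph.reachable_iff_reflTransGen] at hxy
  induction hxy with
  | refl => rfl
  | tail _ hs ih =>
    rw [SimpleGraph.fromEdgeSet_adj] at hs
    obtain ⟨⟨a, ha⟩, -⟩ := hs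
    exact ih.trans (h a _ _ ha)

theorem reachable_of_edge {V : Type} {p : ℕ} {e : Fin p → Sym2 V} {a : Fin p} {x y : V}
    (h : e a = s(x, y)) : (SimpleGraph.fromEdgeSet (Set.range e)).Reachable x y := by
  by_cases hxy : x = y
  · rw [hxy]
  · exact SimpleGraph.Adj.reachable (by rw [SimpleGraph.fromEdgeSet_adj]; exact ⟨⟨a, h⟩, hxy⟩)

theorem IsForest.edgeSet_eq {V : Type} {p : ℕ} {e : Fin p → Sym2 (Option V)} (h : IsForest e) :
    (SimpleGraph.fromEdgeSet (Set.range e)).edgeSet = Set.range e := by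
  rw [SimpleGraph.edgeSet_fromEdgeSet, sdiff_eq_left, Set.disjoint_left]
  rintro _ ⟨a, rfl⟩
  exact h.loopless a

/-- With `n` edges on the `n + 1` vertices of `V ∪ {z}`, having no cycles, loops and repetitions is
the same as being connected. -/
theorem isForest_iff_connected {V : Type} [Finite V] {n : ℕ} (hV : Nat.card V = n)
    (e : Fin n → Sym2 (Option V)) :
    IsForest e ↔ (SimpleGraph.fromEdgeSet (Set.range e)).Connected := by
  have hcard : Nat.card (Option V) = n + 1 := by rw [Finite.card_option, hV]
  constructor
  · intro h
    obtain ⟨T, hGT, -, hT⟩ :=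
      SimpleGraph.connected_top.exists_isTree_le_of_le_of_isAcyclic le_top h.acyclic
    have hTc := (SimpleGraph.isTree_iff_connected_and_card.1 hT).2
    have hGc : Nat.card (Set.range e) = n := by
      rw [Nat.card_range_of_injective h.injective]; simp
    have hsub := SimpleGraph.edgeSet_mono hGT
    have heq : (SimpleGraph.fromEdgeSet (Set.range e)).edgeSet = T.edgeSet := by
      refine Set.eq_of_subset_of_ncard_le hsub ?_ (Set.toFinite _)
      rw [h.edgeSet_eq, ← Nat.card_coe_set_eq, ← Nat.card_coe_set_eq]
      omega
    rw [SimpleGraph.edgeSet_injective heq]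
    exact hT.connected
  · intro h
    have h1 := h.card_vert_le_card_edgeSet_add_one
    have hsub : (SimpleGraph.fromEdgeSet (Set.range e)).edgeSet ⊆ Set.range e := by
      rw [SimpleGraph.edgeSet_fromEdgeSet]; exact Set.sdiff_subset
    have h2 := Nat.card_mono (Set.toFinite _) hsub
    have h3 : Nat.card (Set.range e) ≤ n := by
      simpa using Finite.card_range_le e
    have heq : (SimpleGraph.fromEdgeSet (Set.range e)).edgeSet = Set.range e := by
      refine Set.eq_of_subset_of_ncard_le hsub ?_ (Set.toFinite _)
      rw [← Nat.card_coe_set_eq, ← Nat.card_coe_set_eq]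
      omega
    refine ⟨?_, ?_, ?_⟩
    · have h4 : Nat.card (Fin n) = Nat.card (Set.range e) := by rw [Nat.card_fin]; omega
      have h5 := Set.rangeFactorization_surjective (f := e)
      have h6 := (Nat.bijective_iff_surjective_and_card _).2 ⟨h5, h4⟩
      intro a b hab
      exact h6.1 (Subtype.ext hab)
    · intro a
      have ha : e a ∈ (SimpleGraph.fromEdgeSet (Set.range e)).edgeSet := by
        rw [heq]; exact ⟨a, rfl⟩
      exact SimpleGraph.not_isDiag_of_mem_edgeSet _ ha
    · exact (SimpleGraph.isTree_iff_connected_and_card.2 ⟨h, by omega⟩).isAcyclic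

/-- If the end points of each edge of a spanning tree are connected in another graph with as many
edges, that graph is a spanning tree too. -/
theorem IsForest.of_reachable {V : Type} [Finite V] {n : ℕ} (hV : Nat.card V = n)
    {e e' : Fin n → Sym2 (Option V)} (h : IsForest e)
    (h' : ∀ a x y, e a = s(x, y) → (SimpleGraph.fromEdgeSet (Set.range e')).Reachable x y) :
    IsForest e' := by
  rw [isForest_iff_connected hV] at h ⊢
  exact ⟨fun x y => reachable_map id h' (h.preconnected x y)⟩

/-! ### Grafting a tree onto an edge at the root -/

/-- The map on vertices that puts `t` in the place of the root. -/
def graftVertex {V : Type} (t : V) (x : Option {w : V // w ≠ t}) : Option V :=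
  some (x.elim t Subtype.val)

/-- The forest that consists of the edge `zt` and the forest `e` on the other vertices, rooted at
`t`. Contraction of the first edge gives `e` back. -/
def graft {V : Type} (t : V) {n : ℕ} (e : Fin n → Sym2 (Option {w : V // w ≠ t})) :
    Fin (n + 1) → Sym2 (Option V) :=
  Fin.cons s(none, some t) fun s => Sym2.map (graftVertex t) (e s)

theorem card_ne {V : Type} [Finite V] {n : ℕ} (hV : Nat.card V = n + 1) (t : V) :
    Nat.card {w : V // w ≠ t} = n := by
  have := Fintype.ofFinite V
  classical
  rw [Nat.card_eq_fintype_card] at hV ⊢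
  rw [Fintype.card_subtype_compl, Fintype.card_subtype_eq, hV, Nat.add_sub_cancel]

theorem isForest_graft {V : Type} [Finite V] {n : ℕ} (hV : Nat.card V = n + 1) (t : V)
    {e : Fin n → Sym2 (Option {w : V // w ≠ t})} (h : IsForest e) : IsForest (graft t e) := by
  rw [isForest_iff_connected (card_ne hV t)] at h
  rw [isForest_iff_connected hV]
  have key : ∀ x, (SimpleGraph.fromEdgeSet (Set.range (graft t e))).Reachable (some t)
      (graftVertex t x) := fun x =>
    reachable_map (graftVertex t) (x := none)
      (fun a x y ha => reachable_of_edge (a := a.succ) (by simp [graft, ha]))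
      (h.preconnected none x)
  have key' : ∀ x, (SimpleGraph.fromEdgeSet (Set.range (graft t e))).Reachable (some t) x := by
    intro x
    rcases x with _ | x
    · exact (reachable_of_edge (a := 0) (by simp [graft])).symm
    · by_cases hx : x = t
      · rw [hx]
      · exact key (some ⟨x, hx⟩)
  exact ⟨fun x y => (key' x).symm.trans (key' y)⟩

/-- Grafting as a linear map on classes of forests. -/
def graftMap {V : Type} [Finite V] {n : ℕ} (hV : Nat.card V = n + 1) (t : V) :
    ForestSpace {w : V // w ≠ t} n →ₗ[ℂ] ForestSpace V (n + 1) :=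
  ForestSpace.lift (fun e => cls (graft t e))
    (fun e _ a b hab => by
      have hs : graft t (e ∘ Equiv.swap a b) = graft t e ∘ Equiv.swap a.succ b.succ := by
        funext s
        refine Fin.cases ?_ (fun s => ?_) s
        · simp [graft, Equiv.swap_apply_of_ne_of_ne (Fin.succ_ne_zero a).symm
            (Fin.succ_ne_zero b).symm]
        · rw [Function.comp_apply, ← (Fin.succ_injective n).map_swap, graft, Fin.cons_succ, graft,
            Fin.cons_succ, Function.comp_apply]
      rw [hs, cls_swap _ (fun h => hab (Fin.succ_injective n h)), add_neg_cancel])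
    (fun e₁ e₂ e₃ h₁ h₂ h₃ a b u v w hab t₁ t₂ t₃ hc =>
      cls_triangle (isForest_graft hV t h₁) (isForest_graft hV t h₂) (isForest_graft hV t h₃)
        (a := a.succ) (b := b.succ) (u := graftVertex t u) (v := graftVertex t v)
        (w := graftVertex t w) (fun h => hab (Fin.succ_injective n h))
        (by simp [graft, t₁.1, t₁.2]) (by simp [graft, t₂.1, t₂.2]) (by simp [graft, t₃.1, t₃.2])
        (fun c => by
          refine Fin.cases (fun _ _ => ⟨rfl, rfl⟩) (fun c hca hcb => ?_) c
          have := hc c (fun h => hca (h ▸ rfl)) (fun h => hcb (h ▸ rfl))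
          simp [graft, this.1, this.2]))

theorem graftMap_cls {V : Type} [Finite V] {n : ℕ} (hV : Nat.card V = n + 1) (t : V)
    {e : Fin n → Sym2 (Option {w : V // w ≠ t})} (he : IsForest e) :
    graftMap hV t (cls e) = cls (graft t e) :=
  ForestSpace.lift_cls _ _ _ he

/-- The sequence `t, v 0, v 1, …`. -/
def consEmb {V : Type} (t : V) {n : ℕ} (v : Fin n ↪ {w : V // w ≠ t}) : Fin (n + 1) ↪ V where
  toFun := Fin.cons t fun s => (v s).1
  inj' := by
    rw [Fin.cons_injective_iff]
    refine ⟨?_, Subtype.val_injective.comp v.injective⟩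
    rintro ⟨s, hs⟩
    exact (v s).2 hs

theorem graft_path {V : Type} (t : V) {n : ℕ} (v : Fin n ↪ {w : V // w ≠ t}) :
    graft t (path v) = path (consEmb t v) := by
  funext s
  refine Fin.cases ?_ (fun s => ?_) s
  · simp [graft, path, consEmb]
  · rw [graft, Fin.cons_succ, path, Sym2.map_mk, path]
    refine congrArg₂ (fun x y => s(x, y)) ?_ ?_
    · have hs0 : (s.succ : ℕ) ≠ 0 := Nat.succ_ne_zero _
      rw [dif_neg hs0]
      by_cases hs : (s : ℕ) = 0
      · have h0 : (⟨(s.succ : ℕ) - 1, by lia⟩ : Fin (n + 1)) = 0 := by ext; simp [hs]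
        rw [dif_pos hs, h0]
        simp [graftVertex, consEmb]
      · have h0 : (⟨(s.succ : ℕ) - 1, by lia⟩ : Fin (n + 1)) = Fin.succ ⟨s - 1, by lia⟩ := by
          ext; simp; lia
        rw [dif_neg hs, h0]
        rfl
    · simp [graftVertex, consEmb]

/-! ### Paths span the space of spanning trees -/

open Classical in
/-- The number of edges at the root. -/
def rootDegree {V : Type} {n : ℕ} (e : Fin n → Sym2 (Option V)) : ℕ :=
  (Finset.univ.filter fun a => none ∈ e a).card

theorem rootDegree_pos {V : Type} [Finite V] {n : ℕ} (hV : Nat.card V = n + 1)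
    {e : Fin (n + 1) → Sym2 (Option V)} (he : IsForest e) : 0 < rootDegree e := by
  rw [rootDegree, Finset.card_pos]
  rw [isForest_iff_connected hV] at he
  have : Nonempty V := (Nat.card_pos_iff.1 (by omega)).1
  have t := Classical.arbitrary V
  have hr := he.preconnected none (some t)
  rw [SimpleGraph.reachable_iff_reflTransGen] at hr
  rcases hr.cases_head with h | ⟨y, hy, -⟩
  · simp at h
  · rw [SimpleGraph.fromEdgeSet_adj] at hy
    obtain ⟨⟨a, ha⟩, -⟩ := hy
    exact ⟨a, by simp [ha]⟩

theorem graftVertex_contractVertex {V : Type} (t : V) {x : Option V} (hx : x ≠ none) :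
    graftVertex t (contractVertex t x) = x := by
  obtain ⟨x, rfl⟩ := Option.ne_none_iff_exists'.1 hx
  by_cases h : x = t
  · simp [h, graftVertex]
  · simp [h, graftVertex, contractVertex]

/-- A spanning tree with a single edge at the root is, up to the numbering of its edges, the graft of
its contraction, so its class lies in each submodule that contains the grafts. -/
theorem cls_mem_of_rootDegree_eq_one {V : Type} [Finite V] {n : ℕ} (hV : Nat.card V = n + 1)
    (S : Submodule ℂ (ForestSpace V (n + 1))) (hS : ∀ t x, graftMap hV t x ∈ S)
    {e : Fin (n + 1) → Sym2 (Option V)} (he : IsForest e) (h1 : rootDegree e = 1) :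
    cls e ∈ S := by
  classical
  rw [rootDegree, Finset.card_eq_one] at h1
  obtain ⟨a, ha⟩ := h1
  have hroot : ∀ b, none ∈ e b ↔ b = a := by
    intro b
    have := Finset.ext_iff.1 ha b
    simpa using this
  obtain ⟨y, hy⟩ := (hroot a).2 rfl
  have hyn : y ≠ none := by
    rintro rfl
    exact he.loopless a (by rw [hy]; simp)
  obtain ⟨t, rfl⟩ := Option.ne_none_iff_exists'.1 hyn
  have hg : graft t (fun s => Sym2.map (contractVertex t) (e (a.succAbove s))) =
      e ∘ a.cycleRange.symm := by
    funext s
    refine Fin.cases ?_ (fun s => ?_) s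
    · simp [graft, hy]
    · have hn : none ∉ e (a.succAbove s) := by
        rw [hroot]; exact Fin.succAbove_ne a s
      rw [graft, Fin.cons_succ, Function.comp_apply, Fin.cycleRange_symm_succ, Sym2.map_map]
      refine (Sym2.map_congr (g := id) fun x hx => ?_).trans (by rw [Sym2.map_id, id])
      exact graftVertex_contractVertex t (fun h => hn (h ▸ hx))
  have h := hS t (cls fun s => Sym2.map (contractVertex t) (e (a.succAbove s)))
  rw [graftMap_cls hV t (he.contract hy), hg, cls_perm] at h
  refine (S.smul_mem_iff ?_).1 h
  simp

/-- If the root has two edges, the triangle relation expresses the class of a spanning tree through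
two spanning trees with fewer edges at the root. -/
theorem exists_rootDegree_lt {V : Type} [Finite V] {n : ℕ} (hV : Nat.card V = n)
    {e : Fin n → Sym2 (Option V)} (he : IsForest e) (h : 1 < rootDegree e) :
    ∃ e₂ e₃ : Fin n → Sym2 (Option V), IsForest e₂ ∧ IsForest e₃ ∧ rootDegree e₂ < rootDegree e ∧
      rootDegree e₃ < rootDegree e ∧ cls e + cls e₂ + cls e₃ = 0 := by
  classical
  rw [rootDegree, Finset.one_lt_card] at h
  obtain ⟨a, ha, b, hb, hab⟩ := h
  rw [Finset.mem_filter] at ha hb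
  obtain ⟨v, hv⟩ := ha.2
  obtain ⟨w, hw⟩ := hb.2
  have hvn : v ≠ none := by
    rintro rfl
    exact he.loopless a (by rw [hv]; simp)
  have hwn : w ≠ none := by
    rintro rfl
    exact he.loopless b (by rw [hw]; simp)
  obtain ⟨e₂, he₂⟩ : ∃ e₂, e₂ = Function.update (Function.update e a s(v, w)) b s(none, v) :=
    ⟨_, rfl⟩
  obtain ⟨e₃, he₃⟩ : ∃ e₃, e₃ = Function.update (Function.update e a s(none, w)) b s(v, w) :=
    ⟨_, rfl⟩
  have e₂a : e₂ a = s(v, w) := by simp [he₂, hab]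
  have e₂b : e₂ b = s(none, v) := by simp [he₂]
  have e₃a : e₃ a = s(none, w) := by simp [he₃, hab]
  have e₃b : e₃ b = s(v, w) := by simp [he₃]
  have e₂c : ∀ c, c ≠ a → c ≠ b → e₂ c = e c := fun c hca hcb => by simp [he₂, hca, hcb]
  have e₃c : ∀ c, c ≠ a → c ≠ b → e₃ c = e c := fun c hca hcb => by simp [he₃, hca, hcb]
  -- a graph that keeps the other edges and still connects `none`, `v` and `w` is a spanning tree
  have forest : ∀ e' : Fin n → Sym2 (Option V), (∀ c, c ≠ a → c ≠ b → e' c = e c) →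
      (SimpleGraph.fromEdgeSet (Set.range e')).Reachable none v →
      (SimpleGraph.fromEdgeSet (Set.range e')).Reachable none w → IsForest e' := by
    intro e' hc h1 h2
    have both : ∀ {p q x y : Option V}, (SimpleGraph.fromEdgeSet (Set.range e')).Reachable p q →
        s(p, q) = s(x, y) → (SimpleGraph.fromEdgeSet (Set.range e')).Reachable x y := by
      intro p q x y hpq h
      rcases Sym2.eq_iff.1 h with ⟨rfl, rfl⟩ | ⟨rfl, rfl⟩
      exacts [hpq, hpq.symm]
    refine he.of_reachable hV fun c x y hxy => ?_
    by_cases hca : c = a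
    · subst hca
      exact both h1 (hv.symm.trans hxy)
    by_cases hcb : c = b
    · subst hcb
      exact both h2 (hw.symm.trans hxy)
    · exact reachable_of_edge (a := c) (by rw [hc c hca hcb, hxy])
  have f₂ : IsForest e₂ := forest e₂ e₂c (reachable_of_edge e₂b)
    ((reachable_of_edge e₂b).trans (reachable_of_edge e₂a))
  have f₃ : IsForest e₃ := forest e₃ e₃c
    ((reachable_of_edge e₃a).trans (reachable_of_edge e₃b).symm) (reachable_of_edge e₃a)
  -- one of the edges `a`, `b` has moved away from the root
  have degree : ∀ (e' : Fin n → Sym2 (Option V)) (d : Fin n), (d = a ∨ d = b) → none ∉ e' d →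
      (∀ c, c ≠ a → c ≠ b → e' c = e c) → rootDegree e' < rootDegree e := by
    intro e' d hd hde hc
    refine Finset.card_lt_card ((Finset.ssubset_iff_of_subset fun c hce => ?_).2 ⟨d, ?_, ?_⟩)
    · by_cases hca : c = a
      · simp [hca, ha.2]
      by_cases hcb : c = b
      · simp [hcb, hb.2]
      · simpa [hc c hca hcb] using hce
    · rcases hd with rfl | rfl
      · simp [ha.2]
      · simp [hb.2]
    · simp [hde]
  have hvw : none ∉ s(v, w) := by
    rw [Sym2.mem_iff]
    rintro (h | h)
    exacts [hvn h.symm, hwn h.symm]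
  refine ⟨e₂, e₃, f₂, f₃, degree e₂ a (Or.inl rfl) (e₂a ▸ hvw) e₂c,
    degree e₃ b (Or.inr rfl) (e₃b ▸ hvw) e₃c, ?_⟩
  exact cls_triangle he f₂ f₃ hab ⟨hv, hw⟩ ⟨e₂a, e₂b⟩ ⟨e₃a, e₃b⟩
    fun c hca hcb => ⟨(e₂c c hca hcb).symm, (e₂c c hca hcb).trans (e₃c c hca hcb).symm⟩

theorem cls_mem_of_graft_mem {V : Type} [Finite V] {n : ℕ} (hV : Nat.card V = n + 1)
    (S : Submodule ℂ (ForestSpace V (n + 1))) (hS : ∀ t x, graftMap hV t x ∈ S)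
    {e : Fin (n + 1) → Sym2 (Option V)} (he : IsForest e) : cls e ∈ S := by
  induction hd : rootDegree e using Nat.strong_induction_on generalizing e with
  | _ d ih =>
    subst hd
    rcases (Nat.succ_le_of_lt (rootDegree_pos hV he)).eq_or_lt with h | h
    · exact cls_mem_of_rootDegree_eq_one hV S hS he h.symm
    · obtain ⟨e₂, e₃, f₂, f₃, h₂, h₃, hsum⟩ := exists_rootDegree_lt hV he h
      have : cls e = -(cls e₂ + cls e₃) := by
        rw [eq_neg_iff_add_eq_zero, ← add_assoc, hsum]
      rw [this]
      exact S.neg_mem (S.add_mem (ih _ h₂ f₂ rfl) (ih _ h₃ f₃ rfl))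

theorem eq_top_of_cls_mem {V : Type} {p : ℕ} {S : Submodule ℂ (ForestSpace V p)}
    (h : ∀ e, IsForest e → cls e ∈ S) : S = ⊤ := by
  have : S.mkQ = 0 := ForestSpace.hom_ext fun e he => by simpa using h e he
  rw [← Submodule.ker_mkQ S, this, LinearMap.ker_zero]

theorem span_path_eq_top (n : ℕ) : ∀ (V : Type) [Finite V], Nat.card V = n →
    Submodule.span ℂ (Set.range fun v : Fin n ↪ V => cls (path v)) = ⊤ := by
  induction n with
  | zero =>
    intro V _ _
    refine eq_top_of_cls_mem fun e _ =>
      Submodule.subset_span ⟨⟨fun s => s.elim0, fun s => s.elim0⟩, ?_⟩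
    exact congrArg cls (Subsingleton.elim _ _)
  | succ n ih =>
    intro V _ hV
    refine eq_top_of_cls_mem fun e he => cls_mem_of_graft_mem hV _ (fun t x => ?_) he
    have hx : x ∈ Submodule.span ℂ
        (Set.range fun v : Fin n ↪ {w : V // w ≠ t} => cls (path v)) := by
      rw [ih _ (card_ne hV t)]; trivial
    induction hx using Submodule.span_induction with
    | mem x h =>
      obtain ⟨v, rfl⟩ := h
      simp only
      rw [graftMap_cls hV t (isForest_path v), graft_path]
      exact Submodule.subset_span ⟨_, rfl⟩
    | zero => rw [map_zero]; exact Submodule.zero_mem _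
    | add x y _ _ hx hy => rw [map_add]; exact Submodule.add_mem _ hx hy
    | smul c x _ hx => rw [map_smul]; exact Submodule.smul_mem _ c hx

/-! ### Iterated residues -/

/-- The iterated residues are the coordinates with respect to the paths. -/
theorem eq_zero_of_iterRes_eq_zero {V : Type} [Finite V] {n : ℕ} (hV : Nat.card V = n)
    {x : ForestSpace V n} (h : ∀ v, iterRes n V v x = 0) : x = 0 := by
  have := Fintype.ofFinite V
  classical
  have hx : x ∈ Submodule.span ℂ (Set.range fun v : Fin n ↪ V => cls (path v)) := by
    rw [span_path_eq_top n V hV]; trivial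
  obtain ⟨c, rfl⟩ := (Submodule.mem_span_range_iff_exists_fun ℂ).1 hx
  have hc : ∀ v, c v = 0 := by
    intro v
    have := h v
    simp only [map_sum, map_smul, iterRes_path, smul_eq_mul] at this
    simpa using this
  simp [hc]

/-- Both sides agree on paths, and paths span. -/
theorem iterRes_relabel {V : Type} [Finite V] {n : ℕ} (hV : Nat.card V = n) (σ : Equiv.Perm V)
    (v : Fin n ↪ V) (x : ForestSpace V n) :
    iterRes n V (v.trans σ.toEmbedding) (relabel σ n x) = iterRes n V v x := by
  suffices h : iterRes n V (v.trans σ.toEmbedding) ∘ₗ relabel σ n = iterRes n V v from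
    LinearMap.congr_fun h x
  refine LinearMap.ext_on (span_path_eq_top n V hV) ?_
  rintro _ ⟨v', rfl⟩
  simp only [LinearMap.comp_apply]
  rw [relabel_cls _ _ (isForest_path v'), path_map]
  erw [iterRes_path n V _ (v'.trans σ.toEmbedding)]
  rw [iterRes_path]
  congr 1
  rw [eq_iff_iff]
  constructor
  · intro h
    ext s
    exact σ.injective (DFunLike.congr_fun h s)
  · rintro rfl
    rfl

theorem iterRes_eq_zero_of_res_eq_zero {V : Type} {n : ℕ} (hn : 0 < n) (v : Fin n ↪ V)
    {x : ForestSpace V n} (h : res (v ⟨0, hn⟩) n x = 0) : iterRes n V v x = 0 := by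
  cases n with
  | zero => exact absurd hn (lt_irrefl 0)
  | succ n =>
    rw [iterRes, LinearMap.comp_apply]
    -- the residue lands in degree `n + 1 - 1`, which is `n` by definition only
    erw [h]
    exact map_zero _

/-- A skew-invariant element of positive degree whose residue at the last variable of each kind
vanishes is zero: permuting the variables of one kind, each of them becomes the last one. -/
theorem eq_zero_of_res_lastVar_eq_zero {r : ℕ} {k : Fin r → ℕ} (hk : 0 < size k)
    {x : ForestSpace (Var k) (size k)} (hx : x ∈ skewForests k)
    (h : ∀ i hi, res (lastVar k i hi) (size k) x = 0) : x = 0 := by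
  classical
  have hV : Nat.card (Var k) = size k := by simp
  refine eq_zero_of_iterRes_eq_zero hV fun v => ?_
  obtain ⟨i, j, hij⟩ : ∃ i j, v ⟨0, hk⟩ = ⟨i, j⟩ := ⟨_, _, rfl⟩
  have hi : 0 < k i := j.pos
  let π : ColorGroup k := Pi.mulSingle i (Equiv.swap j (lastVar k i hi).2)
  have hπ : π.toPerm ⟨i, j⟩ = lastVar k i hi := by
    simp [π, ColorGroup.toPerm]
  rw [← iterRes_relabel hV π.toPerm, hx π, map_smul,
    iterRes_eq_zero_of_res_eq_zero hk _ ?_, smul_zero]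
  have hv : (v.trans π.toPerm.toEmbedding) ⟨0, hk⟩ = lastVar k i hi := by
    rw [Function.Embedding.trans_apply, hij]; exact hπ
  rw [hv]
  exact h i hi

theorem PositiveRoot.size_degree_pos {g : Type*} [LieRing g] [LieAlgebra ℂ g]
    {H : LieSubalgebra ℂ g} [H.IsCartanSubalgebra] {r : ℕ} {B : LieAlgebra.Basis (Fin r) H}
    (β : PositiveRoot B) : 0 < size β.degree := by
  rw [Nat.pos_iff_ne_zero]
  intro h
  rw [Finset.sum_eq_zero_iff] at h
  refine β.2.1 (funext fun x => ?_)
  rw [β.degree_spec x]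
  exact Finset.sum_eq_zero fun i hi => by rw [h i hi]; simp

end CanElt

end

theorem mainTheorem9 {g : Type*} [LieRing g] [LieAlgebra ℂ g] [FiniteDimensional ℂ g]
    [LieAlgebra.IsSimple ℂ g] (H : LieSubalgebra ℂ g) [H.IsCartanSubalgebra] {r m : ℕ}
    (B : LieAlgebra.Basis (Fin r) H) (D : CanElt.PBWChoices B m)
    (ηbar : ∀ j : Fin m, CanElt.skewForests (D.degree j))
    (hSerre : ∀ (j : Fin m) (x : FreeAlgebra ℂ (Fin r)), x ∈ CanElt.freePart (D.degree j) →
      x ∈ CanElt.serreIdeal B → CanElt.pairing (D.degree j) x (ηbar j) = 0)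
    (hres : ∀ (j : Fin m) (i : Fin r) (hi : 0 < D.degree j i),
      CanElt.res (CanElt.lastVar (D.degree j) i hi) (CanElt.size (D.degree j)) (ηbar j) =
        CanElt.res (CanElt.lastVar (D.degree j) i hi) (CanElt.size (D.degree j)) (D.eta j)) :
    ∀ j : Fin m, ηbar j = D.eta j := by
  intro j
  rw [← sub_eq_zero]
  refine Subtype.ext (CanElt.eq_zero_of_res_lastVar_eq_zero (D.root j).size_degree_pos
    (ηbar j - D.eta j).2 fun i hi => ?_)
  rw [Submodule.coe_sub, map_sub, hres j i hi, sub_self]
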